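/- Let $(M,g)$ be a smooth Riemannian manifold of dimension $n>2$ with Levi-Civita connection $\nabla$, let $\xi$ be a smooth unit vector field on $M$ that is parallel ($g(\xi,\xi)=1$, $\nabla\xi=0$), and put $\pi(X)=g(X,\xi)$. Let $\tilde\nabla$ be the projective semi-symmetric connection generated by $\xi$, i.e. the linear connection $$\tilde\nabla_XY=\nabla_XY+\psi(Y)X+\psi(X)Y+\phi(Y)X-\phi(X)Y,\qquad \phi=\tfrac12\,\pi,\quad \psi=\tfrac{n-1}{2(n+1)}\,\pi .$$ Let $\tilde R(X,Y)Z=\tilde\nabla_X\tilde\nabla_YZ-\tilde\nabla_Y\tilde\nabla_XZ-\tilde\nabla_{[X,Y]}Z$ be its curvature tensor, $\tilde S(Y,Z)=\operatorname{tr}\bigl(X\mapsto\tilde R(X,Y)Z\bigr)$ its Ricci tensor, and $$\tilde P(X,Y)Z=\tilde R(X,Y)Z-\frac1{n-1}\bigl\{\tilde S(Y,Z)X-\tilde S(X,Z)Y\bigr\}$$ its Weyl projective curvature tensor. Then $M$ is projectively flat with respect to $\tilde\nabla$ (that is, $\tilde P=0$) if and only if $(M,g)$ has constant curvature (that is, there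 is a real number $c$ such that every tangent plane at every point of $M$ has sectional curvature $c$ with respect to $\nabla$). -/

import Mathlib

open Bundle FiberBundle VectorField
open scoped Manifold ContDiff

noncomputable section

/-- A linear connection on an `n`-dimensional manifold `M`, as a covariant derivative on the tangent
bundle. In `D Y x u`, the section `Y` is differentiated at `x` in the direction `u`, so that
`D Y x (X x)` is `(D_X Y)(x)`. -/
abbrev LinearConnection (n : ℕ) (M : Type*) [TopologicalSpace M]
    [ChartedSpace (EuclideanSpace ℝ (Fin n)) M] [IsManifold (𝓡 n) ∞ M] :=
  CovariantDerivative (𝓡 n) (EuclideanSpace ℝ (Fin n)) (fun x : M ↦ TangentSpace (𝓡 n) x)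

namespace LinearConnection

variable {n : ℕ} {M : Type*} [TopologicalSpace M] [ChartedSpace (EuclideanSpace ℝ (Fin n)) M]
  [IsManifold (𝓡 n) ∞ M]

/-- The curvature on vector fields: `R(X, Y)Z = D_X D_Y Z - D_Y D_X Z - D_[X,Y] Z`. -/
def curvature (D : LinearConnection n M) (X Y Z : Π x : M, TangentSpace (𝓡 n) x) :
    Π x : M, TangentSpace (𝓡 n) x := fun x ↦
  D (fun y ↦ D Z y (Y y)) x (X x) - D (fun y ↦ D Z y (X y)) x (Y x)
    - D Z x (mlieBracket (𝓡 n) X Y x)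

/-- The curvature tensor at a point, `R(u, v)w` for tangent vectors `u`, `v`, `w` at `x`: the
curvature on vector fields that extend `u`, `v`, `w` and are smooth near `x`. As the curvature of a
smooth connection is tensorial, the choice of the extension is immaterial. -/
def curvatureAt (D : LinearConnection n M) (x : M) (u v w : TangentSpace (𝓡 n) x) :
    TangentSpace (𝓡 n) x :=
  D.curvature (extend (EuclideanSpace ℝ (Fin n)) u) (extend (EuclideanSpace ℝ (Fin n)) v)
    (extend (EuclideanSpace ℝ (Fin n)) w) x

instance finiteDimensional_tangentSpace (x : M) : FiniteDimensional ℝ (TangentSpace (𝓡 n) x) :=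
  inferInstanceAs (FiniteDimensional ℝ (EuclideanSpace ℝ (Fin n)))

variable [RiemannianBundle (fun x : M ↦ TangentSpace (𝓡 n) x)]

/-- The Ricci tensor `S(v, w) = trace (u ↦ R(u, v)w)`, the trace being computed in an orthonormal
basis of the tangent space at `x`. -/
def ricci (D : LinearConnection n M) (x : M) (v w : TangentSpace (𝓡 n) x) : ℝ :=
  ∑ i, inner ℝ (D.curvatureAt x (stdOrthonormalBasis ℝ (TangentSpace (𝓡 n) x) i) v w)
    (stdOrthonormalBasis ℝ (TangentSpace (𝓡 n) x) i)

/-- The Weyl projective curvature tensor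
`P(u, v)w = R(u, v)w - (S(v, w)u - S(u, w)v) / (n - 1)`. -/
def projectiveCurvature (D : LinearConnection n M) (x : M) (u v w : TangentSpace (𝓡 n) x) :
    TangentSpace (𝓡 n) x :=
  D.curvatureAt x u v w - (1 / ((n : ℝ) - 1)) • (D.ricci x v w • u - D.ricci x u w • v)

/-- `M` is projectively flat with respect to `D`: the projective curvature tensor of `D` vanishes. -/
def IsProjectivelyFlat (D : LinearConnection n M) : Prop :=
  ∀ (x : M) (u v w : TangentSpace (𝓡 n) x), D.projectiveCurvature x u v w = 0

/-- The sectional curvature of the plane spanned by two linearly independent vectors. -/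
def sectionalCurvature (D : LinearConnection n M) (x : M) (u v : TangentSpace (𝓡 n) x) : ℝ :=
  inner ℝ (D.curvatureAt x u v v) u / (inner ℝ u u * inner ℝ v v - inner ℝ u v ^ 2)

/-- All tangent planes at all points have the same sectional curvature. -/
def HasConstantCurvature (D : LinearConnection n M) : Prop :=
  ∃ c : ℝ, ∀ (x : M) (u v : TangentSpace (𝓡 n) x), LinearIndependent ℝ ![u, v] →
    D.sectionalCurvature x u v = c

instance isContMDiffRiemannianBundle_one
    [IsContMDiffRiemannianBundle (𝓡 n) ∞ (EuclideanSpace ℝ (Fin n))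
      (fun x : M ↦ TangentSpace (𝓡 n) x)] :
    IsContMDiffRiemannianBundle (𝓡 n) 1 (EuclideanSpace ℝ (Fin n))
      (fun x : M ↦ TangentSpace (𝓡 n) x) :=
  IsContMDiffRiemannianBundle.of_le (n := ∞) (mod_cast le_top)

/-- The Levi-Civita connection, as the smooth connection that is metric and torsion-free. -/
structure IsLeviCivita
    [IsContMDiffRiemannianBundle (𝓡 n) ∞ (EuclideanSpace ℝ (Fin n))
      (fun x : M ↦ TangentSpace (𝓡 n) x)] (D : LinearConnection n M) : Prop where
  smooth : ContMDiffCovariantDerivativeOn (EuclideanSpace ℝ (Fin n)) ∞ D.toFun Set.univ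
  metric : D.IsMetricCompatible
  torsion_free : D.torsion = 0

/-- The 1-form `π(u) = g(u, ξ)` associated with the vector field `ξ`. -/
def assocForm (ξ : Π x : M, TangentSpace (𝓡 n) x) (x : M) (u : TangentSpace (𝓡 n) x) : ℝ :=
  inner ℝ u (ξ x)

/-- The 1-form `φ = π / 2`. -/
def phiForm (ξ : Π x : M, TangentSpace (𝓡 n) x) (x : M) (u : TangentSpace (𝓡 n) x) : ℝ :=
  1 / 2 * assocForm ξ x u

/-- The 1-form `ψ = (n - 1) / (2 (n + 1)) π`. -/
def psiForm (ξ : Π x : M, TangentSpace (𝓡 n) x) (x : M) (u : TangentSpace (𝓡 n) x) : ℝ :=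
  ((n : ℝ) - 1) / (2 * ((n : ℝ) + 1)) * assocForm ξ x u

/-- `D'` is the projective semi-symmetric connection generated by the connection `D` and `ξ`:
`D'_X Y = D_X Y + ψ(Y)X + ψ(X)Y + φ(Y)X - φ(X)Y` for all vector fields `X`, `Y`. -/
def IsProjectiveSemiSymmetric (D : LinearConnection n M) (ξ : Π x : M, TangentSpace (𝓡 n) x)
    (D' : LinearConnection n M) : Prop :=
  ∀ (x : M) (X Y : Π x : M, TangentSpace (𝓡 n) x), MDifferentiableAt (𝓡 n) ((𝓡 n).prod 𝓘(ℝ, EuclideanSpace ℝ (Fin n)))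
      (fun y ↦ TotalSpace.mk' (EuclideanSpace ℝ (Fin n)) y (X y)) x → MDifferentiableAt (𝓡 n) ((𝓡 n).prod 𝓘(ℝ, EuclideanSpace ℝ (Fin n)))
      (fun y ↦ TotalSpace.mk' (EuclideanSpace ℝ (Fin n)) y (Y y)) x →
    D' Y x (X x) = D Y x (X x) + psiForm ξ x (Y x) • X x + psiForm ξ x (X x) • Y x
      + phiForm ξ x (Y x) • X x - phiForm ξ x (X x) • Y x

/-- Such a connection is semi-symmetric if `D` is torsion-free: `T'(u, v) = π(v)u - π(u)v`. -/
theorem IsProjectiveSemiSymmetric.torsion_eq {D D' : LinearConnection n M}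
    {ξ : Π x : M, TangentSpace (𝓡 n) x} (h : D.IsProjectiveSemiSymmetric ξ D')
    (hD : D.torsion = 0) (x : M) (u v : TangentSpace (𝓡 n) x) :
    D'.torsion x u v = assocForm ξ x v • u - assocForm ξ x u • v := by
  have hu := mdifferentiableAt_extend (𝓡 n) (EuclideanSpace ℝ (Fin n)) u
  have hv := mdifferentiableAt_extend (𝓡 n) (EuclideanSpace ℝ (Fin n)) v
  have h0 := D.torsion_eq_zero_iff.1 hD hu hv
  rw [CovariantDerivative.torsion_apply_eq_extend, h x _ _ hu hv, h x _ _ hv hu, ← h0]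
  simp only [extend_apply_self, phiForm]
  module

/-- Such a connection is projectively equivalent to `D`: `D'_X X` and `D_X X` differ by a multiple
of `X`, so that both have the same geodesics up to parametrization. -/
theorem IsProjectiveSemiSymmetric.self_eq {D D' : LinearConnection n M}
    {ξ : Π x : M, TangentSpace (𝓡 n) x} (h : D.IsProjectiveSemiSymmetric ξ D')
    {x : M} {X : Π x : M, TangentSpace (𝓡 n) x} (hX : MDifferentiableAt (𝓡 n) ((𝓡 n).prod 𝓘(ℝ, EuclideanSpace ℝ (Fin n)))
      (fun y ↦ TotalSpace.mk' (EuclideanSpace ℝ (Fin n)) y (X y)) x) :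
    D' X x (X x) = D X x (X x) + (2 * psiForm ξ x (X x)) • X x := by
  rw [h x X X hX hX]
  module

end LinearConnection

end

/-! Both conditions are equivalent to R = 0, where R is the curvature of the Levi-Civita connection.
The new connection has the form D'_X Y = D_X Y + aπ(Y)X + bπ(X)Y with a = n/(n+1) and b = -1/(n+1).
Since ξ is parallel, Dπ = 0, and R' differs from R only by a²π(Z)(π(Y)X - π(X)Y)
(`curvature_of_eq_add`). The Ricci tensor then gains (n-1)a² π⊗π, which the projective tensor
subtracts again, so P' = P (`projectiveCurvature_projectiveSemiSymmetric`).

Moreover R(u,v)ξ = 0, and the rest is algebra at one point. If P = 0, then R(u,v)w = T(v,w)u -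
T(u,w)v with T = S/(n-1), and skew-adjointness together with R(u,v)ξ = 0 forces R = 0
(`curvatureLike_eq_zero_of_eq_smul_sub`). If the sectional curvature is a constant c, a plane
through ξ gives c = 0, and polarization with the Bianchi identity gives R = 0
(`curvatureLike_eq_zero_of_sectional`); hence P = 0. -/

open scoped Topology

/-! ### Smooth vector fields and linear global extension of tangent vectors -/

namespace LinearConnection

variable {n : ℕ} {M : Type*} [TopologicalSpace M] [ChartedSpace (EuclideanSpace ℝ (Fin n)) M]
  [IsManifold (𝓡 n) ∞ M]

/-- Smoothness of a vector field. -/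
abbrev IsSmoothField (X : Π x : M, TangentSpace (𝓡 n) x) : Prop :=
  ContMDiff (𝓡 n) ((𝓡 n).prod 𝓘(ℝ, EuclideanSpace ℝ (Fin n))) ∞
    (fun y ↦ TotalSpace.mk' (EuclideanSpace ℝ (Fin n)) y (X y))

/-- Differentiability of a vector field at a point. -/
abbrev IsDiffFieldAt (X : Π x : M, TangentSpace (𝓡 n) x) (x : M) : Prop :=
  MDifferentiableAt (𝓡 n) ((𝓡 n).prod 𝓘(ℝ, EuclideanSpace ℝ (Fin n)))
    (fun y ↦ TotalSpace.mk' (EuclideanSpace ℝ (Fin n)) y (X y)) x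

lemma IsSmoothField.diffAt {X : Π x : M, TangentSpace (𝓡 n) x} (h : IsSmoothField X) (x : M) :
    IsDiffFieldAt X x :=
  h.mdifferentiable (by simp) x

lemma IsSmoothField.add {X Y : Π x : M, TangentSpace (𝓡 n) x} (hX : IsSmoothField X)
    (hY : IsSmoothField Y) : IsSmoothField (X + Y) :=
  ContMDiff.add_section hX hY

lemma IsSmoothField.smul {X : Π x : M, TangentSpace (𝓡 n) x} {f : M → ℝ}
    (hX : IsSmoothField X) (hf : ContMDiff (𝓡 n) 𝓘(ℝ) ∞ f) : IsSmoothField (f • X) :=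
  ContMDiff.smul_section hf hX

lemma IsSmoothField.const_smul {X : Π x : M, TangentSpace (𝓡 n) x} (a : ℝ)
    (hX : IsSmoothField X) : IsSmoothField (a • X) :=
  ContMDiff.const_smul_section hX

/-- The extension has constant coordinates in the trivialization at `x`, so it is linear in the
vector over the base set. -/
lemma extend_add {x y : M}
    (hy : y ∈ (trivializationAt (EuclideanSpace ℝ (Fin n))
      (TangentSpace (𝓡 n) : M → Type _) x).baseSet) (u v : TangentSpace (𝓡 n) x) :
    extend (EuclideanSpace ℝ (Fin n)) (u + v) y =
      extend (EuclideanSpace ℝ (Fin n)) u y + extend (EuclideanSpace ℝ (Fin n)) v y := by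
  set t := trivializationAt (EuclideanSpace ℝ (Fin n)) (TangentSpace (𝓡 n) : M → Type _) x
  have hx := FiberBundle.mem_baseSet_trivializationAt' (F := EuclideanSpace ℝ (Fin n))
    (E := (TangentSpace (𝓡 n) : M → Type _)) x
  have h := (t.linear ℝ hx).map_add u v
  change t.symm y (t ⟨x, u + v⟩).2 = t.symm y (t ⟨x, u⟩).2 + t.symm y (t ⟨x, v⟩).2
  rw [h, ← t.coe_symmₗ (R := ℝ) hy, map_add]

lemma extend_smul {x y : M}
    (hy : y ∈ (trivializationAt (EuclideanSpace ℝ (Fin n))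
      (TangentSpace (𝓡 n) : M → Type _) x).baseSet) (a : ℝ) (u : TangentSpace (𝓡 n) x) :
    extend (EuclideanSpace ℝ (Fin n)) (a • u) y =
      a • extend (EuclideanSpace ℝ (Fin n)) u y := by
  set t := trivializationAt (EuclideanSpace ℝ (Fin n)) (TangentSpace (𝓡 n) : M → Type _) x
  have hx := FiberBundle.mem_baseSet_trivializationAt' (F := EuclideanSpace ℝ (Fin n))
    (E := (TangentSpace (𝓡 n) : M → Type _)) x
  have h := (t.linear ℝ hx).map_smul a u
  change t.symm y (t ⟨x, a • u⟩).2 = a • t.symm y (t ⟨x, u⟩).2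
  rw [h, ← t.coe_symmₗ (R := ℝ) hy, map_smul]

/-- There is a smooth function equal to `1` near `x` with which the canonical extensions of all
tangent vectors at `x` can be cut off. -/
lemma exists_cutoff (n : ℕ) {M : Type*} [TopologicalSpace M]
    [ChartedSpace (EuclideanSpace ℝ (Fin n)) M] [IsManifold (𝓡 n) ∞ M] [T2Space M] (x : M) :
    ∃ χ : M → ℝ, χ =ᶠ[𝓝 x] 1 ∧
    (∀ y, χ y = 0 ∨ y ∈ (trivializationAt (EuclideanSpace ℝ (Fin n))
      (TangentSpace (𝓡 n) : M → Type _) x).baseSet) ∧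
    ∀ u : TangentSpace (𝓡 n) x,
      IsSmoothField (χ • extend (EuclideanSpace ℝ (Fin n)) u : Π y : M, TangentSpace (𝓡 n) y) := by
  set t := trivializationAt (EuclideanSpace ℝ (Fin n)) (TangentSpace (𝓡 n) : M → Type _) x
  have ht : t.baseSet ∈ 𝓝 x := t.open_baseSet.mem_nhds
    (FiberBundle.mem_baseSet_trivializationAt' x)
  obtain ⟨χ, -, hχ⟩ := (SmoothBumpFunction.nhds_basis_tsupport (I := 𝓡 n) x).mem_iff.1 ht
  refine ⟨χ, χ.eventuallyEq_one, fun y ↦ or_iff_not_imp_left.2 fun hy ↦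
    hχ (subset_tsupport _ hy), fun u ↦ ?_⟩
  refine ContMDiffOn.smul_section_of_tsupport χ.contMDiff.contMDiffOn t.open_baseSet hχ ?_
  intro y hy
  rw [t.contMDiffWithinAt_section _ hy]
  have : ContMDiffOn (𝓡 n) 𝓘(ℝ, EuclideanSpace ℝ (Fin n)) ∞ (fun _ : M ↦ (t ⟨x, u⟩).2)
    t.baseSet := contMDiffOn_const
  refine this.congr (fun y hy ↦ ?_) y hy
  change (t ⟨y, t.symm y (t ⟨x, u⟩).2⟩).2 = _
  rw [t.apply_mk_symm hy]

/-- A function as in `exists_cutoff`. -/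
noncomputable def cutoff [T2Space M] (x : M) : M → ℝ :=
  (exists_cutoff n x).choose

/-- An extension of a tangent vector to a globally smooth vector field. -/
noncomputable def smoothExtend [T2Space M] {x : M} (u : TangentSpace (𝓡 n) x) :
    Π y : M, TangentSpace (𝓡 n) y :=
  cutoff (n := n) x • extend (EuclideanSpace ℝ (Fin n)) u

section smoothExtend

variable [T2Space M] {x : M}

lemma isSmoothField_smoothExtend (u : TangentSpace (𝓡 n) x) : IsSmoothField (smoothExtend u) :=
  (exists_cutoff n x).choose_spec.2.2 u

lemma smoothExtend_apply (u : TangentSpace (𝓡 n) x) (y : M) :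
    smoothExtend u y = cutoff (n := n) x y • extend (EuclideanSpace ℝ (Fin n)) u y := rfl

lemma cutoff_eventuallyEq_one (x : M) : cutoff (n := n) x =ᶠ[𝓝 x] 1 :=
  (exists_cutoff n x).choose_spec.1

lemma cutoff_eq_zero_or (x y : M) : cutoff (n := n) x y = 0 ∨
    y ∈ (trivializationAt (EuclideanSpace ℝ (Fin n))
      (TangentSpace (𝓡 n) : M → Type _) x).baseSet :=
  (exists_cutoff n x).choose_spec.2.1 y

lemma smoothExtend_eventuallyEq (u : TangentSpace (𝓡 n) x) :
    ∀ᶠ y in 𝓝 x, extend (EuclideanSpace ℝ (Fin n)) u y = smoothExtend u y := by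
  filter_upwards [cutoff_eventuallyEq_one (n := n) x] with y hy
  simp only [Pi.one_apply] at hy
  simp [smoothExtend_apply, hy]

@[simp] lemma smoothExtend_apply_self (u : TangentSpace (𝓡 n) x) : smoothExtend u x = u := by
  rw [← (smoothExtend_eventuallyEq u).self_of_nhds, extend_apply_self]

/-- One cutoff serves all vectors and vanishes off the base set, so linearity holds on all of `M`.
The ℝ-linearity of the curvature on fields thus passes to the curvature at a point. -/
lemma smoothExtend_add (u v : TangentSpace (𝓡 n) x) :
    smoothExtend (u + v) = smoothExtend u + smoothExtend v := by
  ext1 y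
  rcases cutoff_eq_zero_or (n := n) x y with hy | hy
  · simp [smoothExtend_apply, hy]
  · simp [smoothExtend_apply, extend_add hy]

lemma smoothExtend_smul (a : ℝ) (u : TangentSpace (𝓡 n) x) :
    smoothExtend (a • u) = a • smoothExtend u := by
  ext1 y
  rcases cutoff_eq_zero_or (n := n) x y with hy | hy
  · simp [smoothExtend_apply, hy]
  · simp [smoothExtend_apply, extend_smul hy, smul_comm a]

end smoothExtend

/-! ### Lie brackets as commutators of derivations -/

variable {X X' Y Y' Z Z' W : Π x : M, TangentSpace (𝓡 n) x} {x : M}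

lemma IsSmoothField.mlieBracket (hX : IsSmoothField X) (hY : IsSmoothField Y) :
    IsSmoothField (mlieBracket (𝓡 n) X Y) :=
  have : IsManifold (𝓡 n) (((⊤ : ℕ∞) : ℕ∞ω) + 1) M := ‹IsManifold (𝓡 n) ∞ M›
  have : IsManifold (𝓡 n) (minSmoothness ℝ 2) M := .of_le (n := ∞)
    (by simpa using ENat.LEInfty.out)
  ContDiff.mlieBracket_vectorField (n := ⊤) (m := ⊤) hX hY (by simp)

/-- The commutator of the derivatives of a function along vector fields is the derivative along
their Lie bracket. -/
lemma mvfderiv_mlieBracket {f f₁ f₂ : M → ℝ} (hX : IsSmoothField X) (hY : IsSmoothField Y)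
    (hf : ContMDiff (𝓡 n) 𝓘(ℝ) ∞ f) (hW : IsSmoothField W) (hWx : W x ≠ 0)
    (h₁ : ∀ y, mvfderiv (𝓡 n) f y (X y) = f₁ y) (h₂ : ∀ y, mvfderiv (𝓡 n) f y (Y y) = f₂ y)
    (hf₁ : MDifferentiableAt (𝓡 n) 𝓘(ℝ) f₁ x) (hf₂ : MDifferentiableAt (𝓡 n) 𝓘(ℝ) f₂ x) :
    mvfderiv (𝓡 n) f x (mlieBracket (𝓡 n) X Y x) =
      mvfderiv (𝓡 n) f₂ x (X x) - mvfderiv (𝓡 n) f₁ x (Y x) := by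
  have mf : MDifferentiable (𝓡 n) 𝓘(ℝ) f := hf.mdifferentiable (by simp)
  have mW : ∀ y, IsDiffFieldAt W y := hW.diffAt
  have key : ∀ {U : Π x : M, TangentSpace (𝓡 n) x} {g : M → ℝ},
      (∀ y, mvfderiv (𝓡 n) f y (U y) = g y) →
      mlieBracket (𝓡 n) U (f • W) = g • W + f • mlieBracket (𝓡 n) U W := by
    intro U g hg
    ext1 y
    rw [mlieBracket_smul_right (mf y) (mW y), hg]
    rfl
  have mXW := (hX.mlieBracket hW).diffAt x
  have mYW := (hY.mlieBracket hW).diffAt x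
  have : IsManifold (𝓡 n) (minSmoothness ℝ 3) M := .of_le (n := ∞)
    (by simpa using ENat.LEInfty.out)
  have le : minSmoothness ℝ 2 ≤ ∞ := by simpa using ENat.LEInfty.out
  have J := leibniz_identity_mlieBracket_apply ((hX x).of_le le) ((hY x).of_le le) ((hW x).of_le le)
  -- Comparing the Jacobi identities for X, Y, fW and for X, Y, W leaves the claim times W, by the
  -- Leibniz rule `key`; this is why W x ≠ 0 is needed.
  have J' := leibniz_identity_mlieBracket_apply ((hX x).of_le le) ((hY x).of_le le)
    (((hf.smul_section hW) x).of_le le)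
  rw [key h₂, key h₁, mlieBracket_smul_right (mf x) (mW x),
    mlieBracket_add_right (hf₂.smul_section (mW x)) ((mf x).smul_section mYW),
    mlieBracket_add_right (hf₁.smul_section (mW x)) ((mf x).smul_section mXW),
    mlieBracket_smul_right hf₂ (mW x), mlieBracket_smul_right hf₁ (mW x),
    mlieBracket_smul_right (mf x) mYW, mlieBracket_smul_right (mf x) mXW, h₁, h₂, J] at J'
  have : (mvfderiv (𝓡 n) f x (mlieBracket (𝓡 n) X Y x) -
      (mvfderiv (𝓡 n) f₂ x (X x) - mvfderiv (𝓡 n) f₁ x (Y x))) • W x = 0 := by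
    rw [← sub_eq_zero] at J'
    rw [← neg_eq_zero, ← J']
    module
  exact sub_eq_zero.1 ((smul_eq_zero.1 this).resolve_right hWx)

end LinearConnection

/-! ### Curvature of a linear connection -/

namespace LinearConnection

variable {n : ℕ} {M : Type*} [TopologicalSpace M] [ChartedSpace (EuclideanSpace ℝ (Fin n)) M]
  [IsManifold (𝓡 n) ∞ M] {D : LinearConnection n M}
  {X X' Y Y' Z Z' W : Π x : M, TangentSpace (𝓡 n) x} {x : M}

lemma IsDiffFieldAt.congr (h : IsDiffFieldAt X x) (hX : ∀ᶠ y in 𝓝 x, X' y = X y) :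
    IsDiffFieldAt X' x :=
  MDifferentiableAt.congr_of_eventuallyEq h (hX.mono fun y hy ↦ by simp [hy])

lemma apply_eventually_congr (D : LinearConnection n M) (hZ' : IsDiffFieldAt Z' x)
    (hZ : ∀ᶠ y in 𝓝 x, Z y = Z' y) : D Z x = D Z' x :=
  D.isCovariantDerivativeOnUniv.congr_of_eventuallyEq (hZ'.congr hZ) hZ' Filter.univ_mem hZ

/-- The curvature at a point depends on the germs of the vector fields only. -/
lemma curvature_congr (D : LinearConnection n M) (hX : ∀ᶠ y in 𝓝 x, X y = X' y)
    (hY : ∀ᶠ y in 𝓝 x, Y y = Y' y) (hZ : ∀ᶠ y in 𝓝 x, Z y = Z' y)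
    (hZ' : IsSmoothField Z') (hXZ : IsDiffFieldAt (fun y ↦ D Z' y (X' y)) x)
    (hYZ : IsDiffFieldAt (fun y ↦ D Z' y (Y' y)) x) :
    D.curvature X Y Z x = D.curvature X' Y' Z' x := by
  have hD : ∀ᶠ y in 𝓝 x, D Z y = D Z' y :=
    hZ.eventually_nhds.mono fun y hy ↦ D.apply_eventually_congr (hZ'.diffAt y) hy
  have h₁ : ∀ᶠ y in 𝓝 x, D Z y (Y y) = D Z' y (Y' y) := by
    filter_upwards [hD, hY] with y h h' using by rw [h, h']
  have h₂ : ∀ᶠ y in 𝓝 x, D Z y (X y) = D Z' y (X' y) := by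
    filter_upwards [hD, hX] with y h h' using by rw [h, h']
  have hL : mlieBracket (𝓡 n) X Y x = mlieBracket (𝓡 n) X' Y' x :=
    Filter.EventuallyEq.mlieBracket_vectorField_eq hX hY
  rw [curvature, curvature, D.apply_eventually_congr hYZ h₁, D.apply_eventually_congr hXZ h₂,
    hD.self_of_nhds, hX.self_of_nhds, hY.self_of_nhds, hL]

/-- Only two derivatives need to be differentiable: the lemma also serves D', which is not assumed
smooth. -/
lemma curvatureAt_eq [T2Space M] (D : LinearConnection n M) {u v w : TangentSpace (𝓡 n) x}
    (hu : IsDiffFieldAt (fun y ↦ D (smoothExtend w) y (smoothExtend u y)) x)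
    (hv : IsDiffFieldAt (fun y ↦ D (smoothExtend w) y (smoothExtend v y)) x) :
    D.curvatureAt x u v w = D.curvature (smoothExtend u) (smoothExtend v) (smoothExtend w) x :=
  D.curvature_congr (smoothExtend_eventuallyEq u) (smoothExtend_eventuallyEq v)
    (smoothExtend_eventuallyEq w) (isSmoothField_smoothExtend w) hu hv

lemma curvature_antisymm (D : LinearConnection n M) (X Y Z : Π x : M, TangentSpace (𝓡 n) x) :
    D.curvature X Y Z x = -D.curvature Y X Z x := by
  rw [curvature, curvature, mlieBracket_swap_apply, map_neg]
  abel

lemma curvatureAt_antisymm (D : LinearConnection n M) (u v w : TangentSpace (𝓡 n) x) :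
    D.curvatureAt x u v w = -D.curvatureAt x v u w :=
  D.curvature_antisymm _ _ _

lemma apply_add (D : LinearConnection n M) (hX : IsDiffFieldAt X x) (hY : IsDiffFieldAt Y x) :
    D (X + Y) x = D X x + D Y x :=
  D.isCovariantDerivativeOnUniv.add hX hY

lemma apply_smul (D : LinearConnection n M) (a : ℝ) (hX : IsDiffFieldAt X x) :
    D (a • X) x = a • D X x :=
  D.isCovariantDerivativeOnUniv.smul_const a hX

section smooth

variable (hD : ContMDiffCovariantDerivativeOn (EuclideanSpace ℝ (Fin n)) ∞ D.toFun Set.univ)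

include hD

lemma isSmoothField_apply (hX : IsSmoothField X) (hY : IsSmoothField Y) :
    IsSmoothField (fun y ↦ D Y y (X y)) :=
  ContMDiff.clm_bundle_apply (contMDiffOn_univ.1 (hD.contMDiff (σ := Y) hY.contMDiffOn)) hX

lemma curvature_add_left (hX : IsSmoothField X) (hX' : IsSmoothField X') (hZ : IsSmoothField Z) :
    D.curvature (X + X') Y Z x = D.curvature X Y Z x + D.curvature X' Y Z x := by
  have h : (fun y ↦ D Z y ((X + X') y)) = (fun y ↦ D Z y (X y)) + fun y ↦ D Z y (X' y) := by
    ext1 y; simp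
  simp only [curvature]
  rw [h, D.apply_add ((isSmoothField_apply hD hX hZ).diffAt x)
    ((isSmoothField_apply hD hX' hZ).diffAt x),
    mlieBracket_add_left (hX.diffAt x) (hX'.diffAt x)]
  simp only [Pi.add_apply, map_add, add_apply]
  abel

lemma curvature_smul_left (a : ℝ) (hX : IsSmoothField X) (hZ : IsSmoothField Z) :
    D.curvature (a • X) Y Z x = a • D.curvature X Y Z x := by
  have h : (fun y ↦ D Z y ((a • X) y)) = a • (fun y ↦ D Z y (X y)) := by
    ext1 y; simp
  simp only [curvature]
  rw [h, D.apply_smul a ((isSmoothField_apply hD hX hZ).diffAt x),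
    mlieBracket_const_smul_left (hX.diffAt x)]
  simp only [Pi.smul_apply, map_smul, smul_apply, smul_sub]

lemma curvature_add_right (hX : IsSmoothField X) (hY : IsSmoothField Y) (hZ : IsSmoothField Z)
    (hZ' : IsSmoothField Z') :
    D.curvature X Y (Z + Z') x = D.curvature X Y Z x + D.curvature X Y Z' x := by
  have h : ∀ U : Π x : M, TangentSpace (𝓡 n) x, (fun y ↦ D (Z + Z') y (U y)) =
      (fun y ↦ D Z y (U y)) + fun y ↦ D Z' y (U y) := fun U ↦ by
    ext1 y
    rw [D.apply_add (hZ.diffAt y) (hZ'.diffAt y)]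
    rfl
  simp only [curvature]
  rw [h, h, D.apply_add ((isSmoothField_apply hD hY hZ).diffAt x)
    ((isSmoothField_apply hD hY hZ').diffAt x), D.apply_add ((isSmoothField_apply hD hX hZ).diffAt x)
    ((isSmoothField_apply hD hX hZ').diffAt x), D.apply_add (hZ.diffAt x) (hZ'.diffAt x)]
  simp only [add_apply]
  abel

lemma curvature_smul_right (a : ℝ) (hX : IsSmoothField X) (hY : IsSmoothField Y)
    (hZ : IsSmoothField Z) :
    D.curvature X Y (a • Z) x = a • D.curvature X Y Z x := by
  have h : ∀ U : Π x : M, TangentSpace (𝓡 n) x, (fun y ↦ D (a • Z) y (U y)) =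
      a • (fun y ↦ D Z y (U y)) := fun U ↦ by
    ext1 y
    rw [D.apply_smul a (hZ.diffAt y)]
    rfl
  simp only [curvature]
  rw [h, h, D.apply_smul a ((isSmoothField_apply hD hY hZ).diffAt x),
    D.apply_smul a ((isSmoothField_apply hD hX hZ).diffAt x), D.apply_smul a (hZ.diffAt x)]
  simp only [smul_apply, smul_sub]

variable [T2Space M]

lemma curvatureAt_eq_curvature_smoothExtend (u v w : TangentSpace (𝓡 n) x) :
    D.curvatureAt x u v w = D.curvature (smoothExtend u) (smoothExtend v) (smoothExtend w) x :=
  D.curvatureAt_eq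
    ((isSmoothField_apply hD (isSmoothField_smoothExtend u) (isSmoothField_smoothExtend w)).diffAt x)
    ((isSmoothField_apply hD (isSmoothField_smoothExtend v) (isSmoothField_smoothExtend w)).diffAt x)

lemma curvatureAt_add_left (u u' v w : TangentSpace (𝓡 n) x) :
    D.curvatureAt x (u + u') v w = D.curvatureAt x u v w + D.curvatureAt x u' v w := by
  simp only [curvatureAt_eq_curvature_smoothExtend hD, smoothExtend_add]
  exact curvature_add_left hD (isSmoothField_smoothExtend u) (isSmoothField_smoothExtend u')
    (isSmoothField_smoothExtend w)

lemma curvatureAt_smul_left (a : ℝ) (u v w : TangentSpace (𝓡 n) x) :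
    D.curvatureAt x (a • u) v w = a • D.curvatureAt x u v w := by
  simp only [curvatureAt_eq_curvature_smoothExtend hD, smoothExtend_smul]
  exact curvature_smul_left hD a (isSmoothField_smoothExtend u) (isSmoothField_smoothExtend w)

lemma curvatureAt_add_right (u v w w' : TangentSpace (𝓡 n) x) :
    D.curvatureAt x u v (w + w') = D.curvatureAt x u v w + D.curvatureAt x u v w' := by
  simp only [curvatureAt_eq_curvature_smoothExtend hD, smoothExtend_add]
  exact curvature_add_right hD (isSmoothField_smoothExtend u) (isSmoothField_smoothExtend v)
    (isSmoothField_smoothExtend w) (isSmoothField_smoothExtend w')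

lemma curvatureAt_smul_right (a : ℝ) (u v w : TangentSpace (𝓡 n) x) :
    D.curvatureAt x u v (a • w) = a • D.curvatureAt x u v w := by
  simp only [curvatureAt_eq_curvature_smoothExtend hD, smoothExtend_smul]
  exact curvature_smul_right hD a (isSmoothField_smoothExtend u) (isSmoothField_smoothExtend v)
    (isSmoothField_smoothExtend w)

/-- The curvature tensor at a point, as a trilinear map. -/
noncomputable def curvatureTensor (x : M) :
    TangentSpace (𝓡 n) x →ₗ[ℝ] TangentSpace (𝓡 n) x →ₗ[ℝ] TangentSpace (𝓡 n) x →ₗ[ℝ]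
      TangentSpace (𝓡 n) x :=
  LinearMap.mk₂ ℝ
    (fun u v ↦
      { toFun := D.curvatureAt x u v
        map_add' := curvatureAt_add_right hD u v
        map_smul' := fun a w ↦ curvatureAt_smul_right hD a u v w })
    (fun u u' v ↦ LinearMap.ext fun w ↦ curvatureAt_add_left hD u u' v w)
    (fun a u v ↦ LinearMap.ext fun w ↦ curvatureAt_smul_left hD a u v w)
    (fun u v v' ↦ LinearMap.ext fun w ↦ by
      change D.curvatureAt x u (v + v') w = D.curvatureAt x u v w + D.curvatureAt x u v' w
      rw [D.curvatureAt_antisymm, curvatureAt_add_left hD, D.curvatureAt_antisymm v,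
        D.curvatureAt_antisymm v']
      abel)
    (fun a u v ↦ LinearMap.ext fun w ↦ by
      change D.curvatureAt x u (a • v) w = a • D.curvatureAt x u v w
      rw [D.curvatureAt_antisymm, curvatureAt_smul_left hD, D.curvatureAt_antisymm v, smul_neg,
        neg_neg])

lemma curvatureTensor_apply (u v w : TangentSpace (𝓡 n) x) :
    curvatureTensor hD x u v w = D.curvatureAt x u v w := rfl

end smooth

/-- First Bianchi identity for vector fields. -/
lemma curvature_bianchi
    (hD : ContMDiffCovariantDerivativeOn (EuclideanSpace ℝ (Fin n)) ∞ D.toFun Set.univ)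
    (hT : D.torsion = 0) (hX : IsSmoothField X) (hY : IsSmoothField Y) (hZ : IsSmoothField Z) :
    D.curvature X Y Z x + D.curvature Y Z X x + D.curvature Z X Y x = 0 := by
  have key : ∀ {U V : Π x : M, TangentSpace (𝓡 n) x}, IsSmoothField U → IsSmoothField V →
      ∀ y, D V y (U y) = D U y (V y) + mlieBracket (𝓡 n) U V y := fun hU hV y ↦ by
    rw [← D.torsion_eq_zero_iff.1 hT (hU.diffAt y) (hV.diffAt y)]
    abel
  have key2 : ∀ {U V T : Π x : M, TangentSpace (𝓡 n) x}, IsSmoothField U → IsSmoothField V →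
      IsSmoothField T → D (fun y ↦ D V y (U y)) x (T x) =
        D (fun y ↦ D U y (V y)) x (T x) + D (mlieBracket (𝓡 n) U V) x (T x) :=
      fun {U V T} hU hV hT ↦ by
    have h : (fun y ↦ D V y (U y)) = (fun y ↦ D U y (V y)) + mlieBracket (𝓡 n) U V :=
      funext fun y ↦ key hU hV y
    rw [h, D.apply_add ((isSmoothField_apply hD hV hU).diffAt x) ((hU.mlieBracket hV).diffAt x)]
    rfl
  have : IsManifold (𝓡 n) (minSmoothness ℝ 3) M := .of_le (n := ∞)
    (by simpa using ENat.LEInfty.out)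
  have le : minSmoothness ℝ 2 ≤ ∞ := by simpa using ENat.LEInfty.out
  -- Torsion-freeness gives D_X(D_Y Z - D_Z Y) = D_X[Y,Z] = D_[Y,Z]X + [X,[Y,Z]], and cyclically;
  -- only the Jacobi sum survives.
  have J := leibniz_identity_mlieBracket_apply ((hX x).of_le le) ((hY x).of_le le) ((hZ x).of_le le)
  rw [mlieBracket_swap_apply (V := mlieBracket (𝓡 n) X Y)] at J
  have a₁ := key hX (hY.mlieBracket hZ) x
  have a₂ := key hY (hX.mlieBracket hZ) x
  have a₃ := key hZ (hX.mlieBracket hY) x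
  have b₁ := key2 hY hZ hX
  have b₂ := key2 hX hZ hY
  have b₃ := key2 hX hY hZ
  have c : D Y x (mlieBracket (𝓡 n) Z X x) = -D Y x (mlieBracket (𝓡 n) X Z x) := by
    rw [mlieBracket_swap_apply, map_neg]
  simp only [curvature]
  rw [b₁, a₁, J, c, b₂, a₂, b₃, a₃]
  abel

end LinearConnection

/-! ### Metric connections and parallel vector fields -/

namespace LinearConnection

variable {n : ℕ} {M : Type*} [TopologicalSpace M] [ChartedSpace (EuclideanSpace ℝ (Fin n)) M]
  [IsManifold (𝓡 n) ∞ M]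
  {X X' Y Y' Z Z' W : Π x : M, TangentSpace (𝓡 n) x} {x : M}

section metric

variable [RiemannianBundle (fun x : M ↦ TangentSpace (𝓡 n) x)]
    [IsContMDiffRiemannianBundle (𝓡 n) ∞ (EuclideanSpace ℝ (Fin n))
      (fun x : M ↦ TangentSpace (𝓡 n) x)] {D D' : LinearConnection n M}
  {ξ : Π x : M, TangentSpace (𝓡 n) x}

lemma IsDiffFieldAt.inner (hX : IsDiffFieldAt X x) (hY : IsDiffFieldAt Y x) :
    MDifferentiableAt (𝓡 n) 𝓘(ℝ) (fun y ↦ inner ℝ (X y) (Y y)) x :=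
  MDifferentiableAt.inner_bundle hX hY

lemma mvfderiv_inner (hD : D.IsMetricCompatible) (hX : IsDiffFieldAt X x)
    (hY : IsDiffFieldAt Y x) (u : TangentSpace (𝓡 n) x) :
    mvfderiv (𝓡 n) (fun y ↦ inner ℝ (X y) (Y y)) x u =
      inner ℝ (D X x u) (Y x) + inner ℝ (X x) (D Y x u) := by
  have h := hD.mvfderiv_inner_eq (extend (EuclideanSpace ℝ (Fin n)) u) hX hY
  simpa only [extend_apply_self] using h

/-- The curvature operators of a smooth metric connection are skew-adjoint. -/
lemma inner_curvature_add (hs : ContMDiffCovariantDerivativeOn (EuclideanSpace ℝ (Fin n)) ∞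
      D.toFun Set.univ) (hD : D.IsMetricCompatible)
    (hX : IsSmoothField X) (hY : IsSmoothField Y) (hZ : IsSmoothField Z) (hW : IsSmoothField W) :
    inner ℝ (D.curvature X Y Z x) (W x) + inner ℝ (Z x) (D.curvature X Y W x) = 0 := by
  by_cases h0 : Z x = 0 ∧ W x = 0
  · simp [h0.1, h0.2]
  -- The nonvanishing field required by `mvfderiv_mlieBracket`.
  obtain ⟨U, hU, hUx⟩ : ∃ U : Π x : M, TangentSpace (𝓡 n) x, IsSmoothField U ∧ U x ≠ 0 := by
    by_cases hZx : Z x = 0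
    · exact ⟨W, hW, fun h ↦ h0 ⟨hZx, h⟩⟩
    · exact ⟨Z, hZ, hZx⟩
  have d : ∀ {A B : Π x : M, TangentSpace (𝓡 n) x}, IsSmoothField A → IsSmoothField B →
      IsDiffFieldAt (fun y ↦ D B y (A y)) x := fun hA hB ↦ (isSmoothField_apply hs hA hB).diffAt x
  have d₁ : ∀ {A : Π x : M, TangentSpace (𝓡 n) x}, IsSmoothField A →
      MDifferentiableAt (𝓡 n) 𝓘(ℝ) (fun y ↦ inner ℝ (D Z y (A y)) (W y)) x :=
    fun hA ↦ (d hA hZ).inner (hW.diffAt x)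
  have d₂ : ∀ {A : Π x : M, TangentSpace (𝓡 n) x}, IsSmoothField A →
      MDifferentiableAt (𝓡 n) 𝓘(ℝ) (fun y ↦ inner ℝ (Z y) (D W y (A y))) x :=
    fun hA ↦ (hZ.diffAt x).inner (d hA hW)
  -- In the commutator of X and Y on g(Z,W), the mixed terms g(D_X Z, D_Y W) and g(D_Y Z, D_X W)
  -- cancel.
  have key := mvfderiv_mlieBracket (f := fun y ↦ inner ℝ (Z y) (W y)) hX hY
    (ContMDiff.inner_bundle hZ hW) hU hUx
    (fun y ↦ mvfderiv_inner hD (hZ.diffAt y) (hW.diffAt y) (X y))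
    (fun y ↦ mvfderiv_inner hD (hZ.diffAt y) (hW.diffAt y) (Y y))
    ((d₁ hX).add (d₂ hX)) ((d₁ hY).add (d₂ hY))
  have e : ∀ {A : Π x : M, TangentSpace (𝓡 n) x}, IsSmoothField A → ∀ u,
      mvfderiv (𝓡 n) (fun y ↦ inner ℝ (D Z y (A y)) (W y) + inner ℝ (Z y) (D W y (A y))) x u =
      mvfderiv (𝓡 n) (fun y ↦ inner ℝ (D Z y (A y)) (W y)) x u +
      mvfderiv (𝓡 n) (fun y ↦ inner ℝ (Z y) (D W y (A y))) x u := fun hA u ↦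
    congrArg (fun l ↦ l u) (mvfderiv_add (d₁ hA) (d₂ hA))
  rw [e hX, e hY, mvfderiv_inner hD (hZ.diffAt x) (hW.diffAt x),
    mvfderiv_inner hD (d hY hZ) (hW.diffAt x), mvfderiv_inner hD (hZ.diffAt x) (d hY hW),
    mvfderiv_inner hD (d hX hZ) (hW.diffAt x), mvfderiv_inner hD (hZ.diffAt x) (d hX hW)] at key
  simp only [curvature, inner_sub_left, inner_sub_right]
  linarith

/-- The curvature of the connection `D'_X Y = D_X Y + a π(Y) X + b π(X) Y`, where `π` is the 1-form
associated with a parallel vector field and `D` is metric and torsion-free. -/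
lemma curvature_of_eq_add {a b : ℝ} (hD : D.IsLeviCivita) (hξ : IsSmoothField ξ)
    (hξ_parallel : ∀ (x : M) (u : TangentSpace (𝓡 n) x), D ξ x u = 0)
    (hD' : ∀ (x : M) (X Y : Π x : M, TangentSpace (𝓡 n) x), IsDiffFieldAt X x →
      IsDiffFieldAt Y x → D' Y x (X x) =
        D Y x (X x) + (a * inner ℝ (Y x) (ξ x)) • X x + (b * inner ℝ (X x) (ξ x)) • Y x)
    (hX : IsSmoothField X) (hY : IsSmoothField Y) (hZ : IsSmoothField Z) :
    IsDiffFieldAt (fun y ↦ D' Z y (X y)) x ∧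
    D'.curvature X Y Z x = D.curvature X Y Z x + (a ^ 2 * inner ℝ (Z x) (ξ x)) •
      ((inner ℝ (Y x) (ξ x) : ℝ) • X x - (inner ℝ (X x) (ξ x) : ℝ) • Y x) := by
  have i : ∀ {A : Π x : M, TangentSpace (𝓡 n) x}, IsSmoothField A →
      ContMDiff (𝓡 n) 𝓘(ℝ) ∞ (fun y ↦ inner ℝ (A y) (ξ y)) := fun hA ↦
    ContMDiff.inner_bundle hA hξ
  have im : ∀ {A : Π x : M, TangentSpace (𝓡 n) x}, IsSmoothField A → ∀ y,
      MDifferentiableAt (𝓡 n) 𝓘(ℝ) (fun y ↦ inner ℝ (A y) (ξ y)) y := fun hA y ↦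
    (i hA).mdifferentiable (by simp) y
  have e : ∀ {A : Π x : M, TangentSpace (𝓡 n) x}, IsSmoothField A → (fun y ↦ D' Z y (A y)) =
      (fun y ↦ D Z y (A y)) + a • ((fun y ↦ (inner ℝ (Z y) (ξ y) : ℝ)) • A) +
        b • ((fun y ↦ (inner ℝ (A y) (ξ y) : ℝ)) • Z) := fun {A} hA ↦ by
    ext1 y
    rw [hD' y A Z (hA.diffAt y) (hZ.diffAt y)]
    simp only [Pi.add_apply, Pi.smul_apply, Pi.smul_apply', smul_smul]
  have s₁ : ∀ {A : Π x : M, TangentSpace (𝓡 n) x}, IsSmoothField A →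
      IsSmoothField (a • ((fun y ↦ (inner ℝ (Z y) (ξ y) : ℝ)) • A)) := fun hA ↦
    (hA.smul (i hZ)).const_smul a
  have s₂ : ∀ {A : Π x : M, TangentSpace (𝓡 n) x}, IsSmoothField A →
      IsSmoothField (b • ((fun y ↦ (inner ℝ (A y) (ξ y) : ℝ)) • Z)) := fun hA ↦
    (hZ.smul (i hA)).const_smul b
  have s : ∀ {A : Π x : M, TangentSpace (𝓡 n) x}, IsSmoothField A →
      IsSmoothField (fun y ↦ D' Z y (A y)) := fun hA ↦ by
    rw [e hA]
    exact ((isSmoothField_apply hD.smooth hA hZ).add (s₁ hA)).add (s₂ hA)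
  refine ⟨(s hX).diffAt x, ?_⟩
  -- Leibniz rule for π(A)B; since ξ is parallel, the derivative of π(A) along u is π(D_u A).
  have l : ∀ {A B : Π x : M, TangentSpace (𝓡 n) x}, IsSmoothField A → IsSmoothField B →
      ∀ u : TangentSpace (𝓡 n) x, D ((fun y ↦ (inner ℝ (A y) (ξ y) : ℝ)) • B) x u =
        (inner ℝ (A x) (ξ x) : ℝ) • D B x u + (inner ℝ (D A x u) (ξ x) : ℝ) • B x :=
    fun {A B} hA hB u ↦ by
      have h := D.isCovariantDerivativeOnUniv.leibniz (hB.diffAt x) (im hA x)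
      have h' := mvfderiv_inner hD.metric (hA.diffAt x) (hξ.diffAt x) u
      rw [hξ_parallel, inner_zero_right, add_zero] at h'
      rw [← h', h]
      rfl
  have key : ∀ {A B : Π x : M, TangentSpace (𝓡 n) x}, IsSmoothField A → IsSmoothField B →
      D' (fun y ↦ D' Z y (A y)) x (B x) = D (fun y ↦ D Z y (A y)) x (B x)
        + a • ((inner ℝ (Z x) (ξ x) : ℝ) • D A x (B x)
          + (inner ℝ (D Z x (B x)) (ξ x) : ℝ) • A x)
        + b • ((inner ℝ (A x) (ξ x) : ℝ) • D Z x (B x)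
          + (inner ℝ (D A x (B x)) (ξ x) : ℝ) • Z x)
        + (a * (inner ℝ (D Z x (A x)) (ξ x) +
          (a + b) * inner ℝ (Z x) (ξ x) * inner ℝ (A x) (ξ x))) • B x
        + (b * inner ℝ (B x) (ξ x)) • (D Z x (A x) + (a * inner ℝ (Z x) (ξ x)) • A x
          + (b * inner ℝ (A x) (ξ x)) • Z x) := fun {A B} hA hB ↦ by
    rw [hD' x B _ (hB.diffAt x) ((s hA).diffAt x), hD' x A Z (hA.diffAt x) (hZ.diffAt x), e hA,
      D.apply_add (((isSmoothField_apply hD.smooth hA hZ).add (s₁ hA)).diffAt x)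
        ((s₂ hA).diffAt x),
      D.apply_add ((isSmoothField_apply hD.smooth hA hZ).diffAt x) ((s₁ hA).diffAt x),
      D.apply_smul a ((hA.smul (i hZ)).diffAt x),
      D.apply_smul b ((hZ.smul (i hA)).diffAt x)]
    simp only [add_apply, smul_apply, l hZ hA, l hA hZ, inner_add_left, real_inner_smul_left]
    congr 3
    ring
  have hb : mlieBracket (𝓡 n) X Y x = D Y x (X x) - D X x (Y x) :=
    (D.torsion_eq_zero_iff.1 hD.torsion_free (hX.diffAt x) (hY.diffAt x)).symm
  have hb' := hD' x (mlieBracket (𝓡 n) X Y) Z ((hX.mlieBracket hY).diffAt x) (hZ.diffAt x)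
  -- Terms symmetric in X, Y cancel, and those in D_X Y - D_Y X are absorbed by D'_[X,Y]Z. The
  -- remaining coefficient is a(a+b) - ab = a².
  rw [curvature, key hY hX, key hX hY, hb', curvature, hb, inner_sub_left]
  module

end metric

end LinearConnection

/-! ### Algebra of curvature-like tensors -/

section algebra

variable {V : Type*} [NormedAddCommGroup V] [InnerProductSpace ℝ V]
  {R : V →ₗ[ℝ] V →ₗ[ℝ] V →ₗ[ℝ] V} {ξ : V}

/-- A tensor `R(u, v)w` that is skew-adjoint in `w`, vanishes on a unit vector, and has the form
`T(v, w)u - T(u, w)v`, is zero. -/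
lemma curvatureLike_eq_zero_of_eq_smul_sub
    (hskew : ∀ u v w z, inner ℝ (R u v w) z + inner ℝ w (R u v z) = 0)
    (hξ : inner ℝ ξ ξ = (1 : ℝ)) (hRξ : ∀ u v, R u v ξ = 0) {T : V → V → ℝ}
    (hT : ∀ u v w, R u v w = T v w • u - T u w • v) (u v w : V) : R u v w = 0 := by
  -- Expand g(R(u,ξ)w, ξ) = 0.
  have h1 : ∀ u w, T u w = T ξ w * inner ℝ u ξ := fun u w ↦ by
    have h := hskew u ξ w ξ
    rw [hRξ, inner_zero_right, hT, inner_sub_left, real_inner_smul_left, real_inner_smul_left,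
      hξ] at h
    linarith
  -- Expand g(R(w,ξ)w, w) = 0.
  have h2 : T ξ w * (inner ℝ w w - inner ℝ w ξ ^ 2) = 0 := by
    have h := hskew w ξ w w
    rw [real_inner_comm, hT, inner_sub_right, real_inner_smul_right, real_inner_smul_right,
      h1 w w] at h
    linear_combination h / 2
  rcases mul_eq_zero.1 h2 with h0 | h0
  · rw [hT, h1 v, h1 u, h0]
    simp
  -- Equality in Cauchy–Schwarz: w is a multiple of ξ, on which R vanishes.
  · have hw : w = (inner ℝ w ξ : ℝ) • ξ := by
      rw [← sub_eq_zero, ← inner_self_eq_zero (𝕜 := ℝ)]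
      simp only [inner_sub_left, inner_sub_right, real_inner_smul_left, real_inner_smul_right, hξ,
        real_inner_comm w ξ]
      linear_combination h0
    rw [hw, map_smul, hRξ, smul_zero]

/-- Pair symmetry of a curvature-like tensor. -/
lemma curvatureLike_pair_symm (hanti : ∀ u v w, R u v w = -R v u w)
    (hskew : ∀ u v w z, inner ℝ (R u v w) z + inner ℝ w (R u v z) = 0)
    (hB : ∀ u v w, R u v w + R v w u + R w u v = 0) (u v w z : V) :
    inner ℝ (R u v w) z = inner ℝ (R w z u) v := by
  have a : ∀ u v w z, inner ℝ (R u v w) z = -inner ℝ (R v u w) z := fun u v w z ↦ by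
    rw [hanti, inner_neg_left]
  have s : ∀ u v w z, inner ℝ (R u v w) z = -inner ℝ (R u v z) w := fun u v w z ↦ by
    rw [real_inner_comm w (R u v z)]
    linarith [hskew u v w z]
  have b : ∀ u v w z, inner ℝ (R u v w) z + inner ℝ (R v w u) z + inner ℝ (R w u v) z = 0 :=
    fun u v w z ↦ by rw [← inner_add_left, ← inner_add_left, hB, inner_zero_left]
  -- Milnor's octahedron: the Bianchi identities for the four cyclic shifts of u, v, w, z, combined
  -- modulo the two skew symmetries.
  linarith [b u v w z, b v w z u, b w z u v, b z u v w, s u v w z, a u v w z, s v w u z, s w u v z,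
    s v w z u, s w z v u, s z v w u, s w z u v, s z u w v, s u w z v, s z u v w, s u v z w,
    s v z u w, a v w u z, a w u v z, a w z v u, a z v w u, a z u w v, a u w z v, a v z u w,
    a u v z w, a v w z u, a w z u v, a z u v w]

/-- A curvature-like tensor with constant sectional curvature that vanishes on a unit vector is
zero in dimension at least two. -/
lemma curvatureLike_eq_zero_of_sectional (hdim : 1 < Module.finrank ℝ V)
    (hanti : ∀ u v w, R u v w = -R v u w)
    (hskew : ∀ u v w z, inner ℝ (R u v w) z + inner ℝ w (R u v z) = 0)
    (hB : ∀ u v w, R u v w + R v w u + R w u v = 0)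
    (hξ : inner ℝ ξ ξ = (1 : ℝ)) (hRξ : ∀ u v, R u v ξ = 0) {c : ℝ}
    (hc : ∀ u v, LinearIndependent ℝ ![u, v] →
      inner ℝ (R u v v) u / (inner ℝ u u * inner ℝ v v - inner ℝ u v ^ 2) = c)
    (u v w : V) : R u v w = 0 := by
  have hξ0 : ξ ≠ 0 := by
    rintro rfl
    simp at hξ
  have hself : ∀ u w, R u u w = 0 := fun u w ↦ by
    have h := eq_neg_iff_add_eq_zero.1 (hanti u u w)
    rw [← two_smul ℝ] at h
    exact (smul_eq_zero.1 h).resolve_left two_ne_zero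
  -- A plane containing ξ has sectional curvature zero, since g(R(ξ,y)y, ξ) = -g(y, R(ξ,y)ξ).
  obtain rfl : c = 0 := by
    obtain ⟨y, hy⟩ := exists_linearIndependent_pair_of_one_lt_finrank hdim hξ0
    have h := hskew ξ y y ξ
    rw [hRξ, inner_zero_right, add_zero] at h
    rw [← hc ξ y hy, h, zero_div]
  have hq : ∀ u v, inner ℝ (R u v v) u = (0 : ℝ) := fun u v ↦ by
    -- If the Gram determinant vanishes, u is a multiple of v or v = 0; otherwise u, v are
    -- independent and `hc` applies.
    by_cases hG : inner ℝ u u * inner ℝ v v - inner ℝ u v ^ 2 = (0 : ℝ)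
    · by_cases hv : v = 0
      · simp [hv]
      have hv' : inner ℝ v v ≠ (0 : ℝ) := fun h ↦ hv (inner_self_eq_zero.1 h)
      have hu : u = (inner ℝ u v / inner ℝ v v : ℝ) • v := by
        rw [← sub_eq_zero, ← inner_self_eq_zero (𝕜 := ℝ)]
        simp only [inner_sub_left, inner_sub_right, real_inner_smul_left, real_inner_smul_right,
          real_inner_comm u v]
        field_simp
        linear_combination hG
      rw [hu, map_smul, LinearMap.smul_apply, LinearMap.smul_apply, hself, smul_zero,
        inner_zero_left]
    · refine (div_eq_zero_iff.1 (hc u v ?_)).resolve_right hG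
      rw [LinearIndependent.pair_iff]
      intro s t hst
      have h1 := congrArg (inner ℝ u) hst
      have h2 := congrArg (inner ℝ v) hst
      simp only [inner_add_right, real_inner_smul_right, inner_zero_right,
        real_inner_comm u v] at h1 h2
      constructor
      · refine (mul_eq_zero.1 ?_).resolve_right hG
        linear_combination inner ℝ v v * h1 - inner ℝ u v * h2
      · refine (mul_eq_zero.1 ?_).resolve_right hG
        linear_combination inner ℝ u u * h2 - inner ℝ u v * h1
  -- Polarization in u: by pair symmetry, g(R(u,v)v, z) is symmetric in u and z.
  have hd : ∀ u v, R u v v = 0 := fun u v ↦ by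
    refine ext_inner_right ℝ fun z ↦ ?_
    have h := hq (u + z) v
    simp only [map_add, LinearMap.add_apply, inner_add_left, inner_add_right, hq] at h
    have h' : inner ℝ (R z v v) u = inner ℝ (R u v v) z := by
      rw [curvatureLike_pair_symm hanti hskew hB z v v u, hanti v u z, inner_neg_left]
      have := hskew u v z v
      rw [real_inner_comm] at this ⊢
      rw [real_inner_comm (R u v v) z] at this
      linarith
    rw [inner_zero_left]
    linarith
  -- Polarization in v. R is now alternating in all three arguments, hence cyclically invariant, and
  -- Bianchi reads 3R = 0.
  have hs : ∀ u v w, R u v w = -R u w v := fun u v w ↦ by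
    have h := hd u (v + w)
    simp only [map_add, LinearMap.add_apply, hd, zero_add, add_zero] at h
    exact eq_neg_of_add_eq_zero_right h
  have h3 := hB u v w
  have e1 : R v w u = R u v w := by rw [hs, hanti v u w, neg_neg]
  have e2 : R w u v = R u v w := by rw [hanti, hs, neg_neg]
  rw [e1, e2] at h3
  have : (3 : ℝ) • R u v w = 0 := by
    rw [← h3]
    module
  exact (smul_eq_zero.1 this).resolve_left (by norm_num)

end algebra

/-! ### Comparison of the two connections and conclusion -/

namespace LinearConnection

variable {n : ℕ} {M : Type*} [TopologicalSpace M] [T2Space M]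
  [ChartedSpace (EuclideanSpace ℝ (Fin n)) M] [IsManifold (𝓡 n) ∞ M]
  [RiemannianBundle (fun x : M ↦ TangentSpace (𝓡 n) x)]
  [IsContMDiffRiemannianBundle (𝓡 n) ∞ (EuclideanSpace ℝ (Fin n))
    (fun x : M ↦ TangentSpace (𝓡 n) x)] {D D' : LinearConnection n M}
  {ξ : Π x : M, TangentSpace (𝓡 n) x} {x : M}

lemma inner_curvatureAt_add (hD : D.IsLeviCivita) (u v w z : TangentSpace (𝓡 n) x) :
    inner ℝ (D.curvatureAt x u v w) z + inner ℝ w (D.curvatureAt x u v z) = 0 := by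
  have h := inner_curvature_add (x := x) hD.smooth hD.metric (isSmoothField_smoothExtend u)
    (isSmoothField_smoothExtend v) (isSmoothField_smoothExtend w) (isSmoothField_smoothExtend z)
  rwa [← curvatureAt_eq_curvature_smoothExtend hD.smooth,
    ← curvatureAt_eq_curvature_smoothExtend hD.smooth, smoothExtend_apply_self,
    smoothExtend_apply_self] at h

lemma curvatureAt_bianchi (hD : D.IsLeviCivita) (u v w : TangentSpace (𝓡 n) x) :
    D.curvatureAt x u v w + D.curvatureAt x v w u + D.curvatureAt x w u v = 0 := by
  simp only [curvatureAt_eq_curvature_smoothExtend hD.smooth]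
  exact curvature_bianchi hD.smooth hD.torsion_free (isSmoothField_smoothExtend u)
    (isSmoothField_smoothExtend v) (isSmoothField_smoothExtend w)

/-- The curvature vanishes on parallel vector fields. -/
lemma curvatureAt_parallel (hD : D.IsLeviCivita) (hξ : IsSmoothField ξ)
    (hξ_parallel : ∀ (x : M) (u : TangentSpace (𝓡 n) x), D ξ x u = 0)
    (u v : TangentSpace (𝓡 n) x) : D.curvatureAt x u v (ξ x) = 0 := by
  have h0 : D.curvature (smoothExtend u) (smoothExtend v) ξ x = 0 := by
    have h : ∀ X : Π x : M, TangentSpace (𝓡 n) x, (fun y ↦ D ξ y (X y)) = 0 := fun X ↦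
      funext fun y ↦ hξ_parallel y (X y)
    rw [curvature, h, h, D.zero, hξ_parallel]
    simp
  -- `h0` concerns the field ξ, not the extension of its value at `x`. Skew-adjointness on fields
  -- gives g(R(u,v)w, ξ) = 0, and at the point it moves R back onto ξ(x).
  refine ext_inner_right ℝ fun w ↦ ?_
  have h1 := inner_curvature_add (x := x) hD.smooth hD.metric (isSmoothField_smoothExtend u)
    (isSmoothField_smoothExtend v) (isSmoothField_smoothExtend w) hξ
  rw [h0, inner_zero_right, add_zero, ← curvatureAt_eq_curvature_smoothExtend hD.smooth] at h1
  have h2 := inner_curvatureAt_add hD u v w (ξ x)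
  rw [h1, zero_add, real_inner_comm] at h2
  rw [h2, inner_zero_left]

lemma curvatureAt_projectiveSemiSymmetric (hD : D.IsLeviCivita) (hξ : IsSmoothField ξ)
    (hξ_parallel : ∀ (x : M) (u : TangentSpace (𝓡 n) x), D ξ x u = 0)
    (hD' : D.IsProjectiveSemiSymmetric ξ D') (u v w : TangentSpace (𝓡 n) x) :
    D'.curvatureAt x u v w = D.curvatureAt x u v w +
      ((((n : ℝ) - 1) / (2 * ((n : ℝ) + 1)) + 1 / 2) ^ 2 * inner ℝ w (ξ x)) •
        ((inner ℝ v (ξ x) : ℝ) • u - (inner ℝ u (ξ x) : ℝ) • v) := by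
  -- Here a is the coefficient of ψ + φ and b that of ψ - φ.
  have h : ∀ (x : M) (X Y : Π x : M, TangentSpace (𝓡 n) x), IsDiffFieldAt X x →
      IsDiffFieldAt Y x → D' Y x (X x) = D Y x (X x) +
        ((((n : ℝ) - 1) / (2 * ((n : ℝ) + 1)) + 1 / 2) * inner ℝ (Y x) (ξ x)) • X x +
        ((((n : ℝ) - 1) / (2 * ((n : ℝ) + 1)) - 1 / 2) * inner ℝ (X x) (ξ x)) • Y x :=
    fun x X Y hX hY ↦ by
      rw [hD' x X Y hX hY]
      simp only [psiForm, phiForm, assocForm]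
      module
  have su := isSmoothField_smoothExtend u
  have sv := isSmoothField_smoothExtend v
  have sw := isSmoothField_smoothExtend w
  have h1 := curvature_of_eq_add (x := x) hD hξ hξ_parallel h su sv sw
  have h2 := curvature_of_eq_add (x := x) hD hξ hξ_parallel h sv su sw
  rw [D'.curvatureAt_eq h1.1 h2.1, h1.2, curvatureAt_eq_curvature_smoothExtend hD.smooth]
  simp only [smoothExtend_apply_self]

/-- The trace of u ↦ π(v)u - π(u)v is (n-1)π(v). -/
lemma ricci_projectiveSemiSymmetric (hD : D.IsLeviCivita) (hξ : IsSmoothField ξ)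
    (hξ_parallel : ∀ (x : M) (u : TangentSpace (𝓡 n) x), D ξ x u = 0)
    (hD' : D.IsProjectiveSemiSymmetric ξ D') (v w : TangentSpace (𝓡 n) x) :
    D'.ricci x v w = D.ricci x v w +
      (((n : ℝ) - 1) / (2 * ((n : ℝ) + 1)) + 1 / 2) ^ 2 * inner ℝ w (ξ x) *
        (((n : ℝ) - 1) * inner ℝ v (ξ x)) := by
  set e := stdOrthonormalBasis ℝ (TangentSpace (𝓡 n) x) with he
  have hn : Module.finrank ℝ (TangentSpace (𝓡 n) x) = n := finrank_euclideanSpace_fin (𝕜 := ℝ)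
  have hs : ∑ i, inner ℝ v (e i) * inner ℝ (e i) (ξ x) = inner ℝ v (ξ x) :=
    e.sum_inner_mul_inner v (ξ x)
  have hone : ∀ i, inner ℝ (e i) (e i) = (1 : ℝ) := fun i ↦ by
    rw [real_inner_self_eq_norm_sq, e.norm_eq_one, one_pow]
  have hcard : ∑ _i : Fin (Module.finrank ℝ (TangentSpace (𝓡 n) x)), (1 : ℝ) = n := by
    simp [hn]
  simp only [ricci, ← he, curvatureAt_projectiveSemiSymmetric hD hξ hξ_parallel hD',
    inner_add_left, inner_sub_left, real_inner_smul_left, Finset.sum_add_distrib, hone,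
    ← Finset.mul_sum, Finset.sum_sub_distrib, hcard]
  simp only [mul_comm (inner ℝ (e _) (ξ x)) (inner ℝ v (e _)), hs]
  ring

/-- The projective curvature tensor is not affected by passing to the projective semi-symmetric
connection generated by a parallel vector field. -/
lemma projectiveCurvature_projectiveSemiSymmetric (hn : 1 < n) (hD : D.IsLeviCivita)
    (hξ : IsSmoothField ξ) (hξ_parallel : ∀ (x : M) (u : TangentSpace (𝓡 n) x), D ξ x u = 0)
    (hD' : D.IsProjectiveSemiSymmetric ξ D') (u v w : TangentSpace (𝓡 n) x) :
    D'.projectiveCurvature x u v w = D.projectiveCurvature x u v w := by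
  have hn' : (n : ℝ) - 1 ≠ 0 := sub_ne_zero.2 (by exact_mod_cast hn.ne')
  have h : ∀ s a b : ℝ, 1 / ((n : ℝ) - 1) * (s + a * (((n : ℝ) - 1) * b)) =
      1 / ((n : ℝ) - 1) * s + a * b := fun s a b ↦ by field_simp
  simp only [projectiveCurvature, ricci_projectiveSemiSymmetric hD hξ hξ_parallel hD',
    curvatureAt_projectiveSemiSymmetric hD hξ hξ_parallel hD', smul_sub, smul_smul, h]
  module

/-- The connection generated by a parallel unit vector field is projectively flat if and only if
the manifold has constant curvature. -/
lemma isProjectivelyFlat_iff_hasConstantCurvature (hn : 1 < n) (hD : D.IsLeviCivita)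
    (hξ_smooth : IsSmoothField ξ) (hξ_unit : ∀ x : M, inner ℝ (ξ x) (ξ x) = (1 : ℝ))
    (hξ_parallel : ∀ (x : M) (u : TangentSpace (𝓡 n) x), D ξ x u = 0)
    (hD' : D.IsProjectiveSemiSymmetric ξ D') :
    D'.IsProjectivelyFlat ↔ D.HasConstantCurvature := by
  have hP : D'.IsProjectivelyFlat ↔
      ∀ (x : M) (u v w : TangentSpace (𝓡 n) x), D.projectiveCurvature x u v w = 0 := by
    simp only [IsProjectivelyFlat, projectiveCurvature_projectiveSemiSymmetric hn
      hD hξ_smooth hξ_parallel hD']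
  rw [hP]
  constructor
  · intro h
    -- The constant must be 0, because planes through ξ are flat.
    refine ⟨0, fun x u v _ ↦ ?_⟩
    have hR : D.curvatureAt x u v v = 0 :=
      curvatureLike_eq_zero_of_eq_smul_sub (R := curvatureTensor hD.smooth x)
        (inner_curvatureAt_add hD) (hξ_unit x) (curvatureAt_parallel hD hξ_smooth hξ_parallel)
        (T := fun v w ↦ 1 / ((n : ℝ) - 1) * D.ricci x v w)
        (fun u v w ↦ by
          rw [curvatureTensor_apply, sub_eq_zero.1 (h x u v w), smul_sub, smul_smul, smul_smul])
        u v v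
    rw [sectionalCurvature, hR, inner_zero_left, zero_div]
  · rintro ⟨c, hc⟩ x u v w
    have hR : ∀ u v w, D.curvatureAt x u v w = 0 :=
      curvatureLike_eq_zero_of_sectional (R := curvatureTensor hD.smooth x)
        (by
          rw [show Module.finrank ℝ (TangentSpace (𝓡 n) x) = n from
            finrank_euclideanSpace_fin (𝕜 := ℝ)]
          exact hn)
        D.curvatureAt_antisymm (inner_curvatureAt_add hD) (curvatureAt_bianchi hD) (hξ_unit x)
        (curvatureAt_parallel hD hξ_smooth hξ_parallel) (hc x)
    simp [projectiveCurvature, ricci, hR]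

end LinearConnection

theorem theorem3p3 {n : ℕ} (hn : 2 < n)
    {M : Type*} [TopologicalSpace M] [T2Space M] [ChartedSpace (EuclideanSpace ℝ (Fin n)) M]
    [IsManifold (𝓡 n) ∞ M]
    [RiemannianBundle (fun x : M ↦ TangentSpace (𝓡 n) x)]
    [IsContMDiffRiemannianBundle (𝓡 n) ∞ (EuclideanSpace ℝ (Fin n))
      (fun x : M ↦ TangentSpace (𝓡 n) x)]
    (D : LinearConnection n M) (hD : D.IsLeviCivita)
    (ξ : Π x : M, TangentSpace (𝓡 n) x)
    (hξ_smooth : ContMDiff (𝓡 n) ((𝓡 n).prod 𝓘(ℝ, EuclideanSpace ℝ (Fin n))) ∞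
      (fun x ↦ TotalSpace.mk' (EuclideanSpace ℝ (Fin n)) x (ξ x)))
    (hξ_unit : ∀ x : M, inner ℝ (ξ x) (ξ x) = 1)
    (hξ_parallel : ∀ (x : M) (u : TangentSpace (𝓡 n) x), D ξ x u = 0)
    (D' : LinearConnection n M) (hD' : D.IsProjectiveSemiSymmetric ξ D') :
    D'.IsProjectivelyFlat ↔ D.HasConstantCurvature :=
  LinearConnection.isProjectivelyFlat_iff_hasConstantCurvature (by omega) hD hξ_smooth hξ_unit
    hξ_parallel hD'
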